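/- Theorem 3.4. Let $n\ge 2$ and $k\ge 1$. Let $\tilde H=SL_n(\mathbb C)\times SL_n(\mathbb C)$ act on the space $M_n(\mathbb C)$ of $n\times n$ complex matrices by $(A,B)\cdot X=AXB^{t}$. Let $T=\{(A,(A^{-1})^{t}) : A\in SL_n(\mathbb C)\}\subseteq\tilde H$, the copy of $SL_n(\mathbb C)$ acting by the conjugations $X\mapsto AXA^{-1}$, and let $P=\{(A,B)\in\tilde H : \mathrm{perm}(AXB^{t})=\mathrm{perm}(X)\text{ for all }X\in M_n(\mathbb C)\}$ be the stabilizer of the permanent. Let $\rho$ be a polynomial representation of $\tilde H^k$ on a complex vector space $W$, i.e. for every $v\in W$ there are finitely many vectors $u_i\in W$ and polynomials $p_i$ in the matrix entries with $\rho(\sigma)v=\sum_i p_i(\sigma)u_i$ for all $\sigma\in\tilde H^k$ (for finite dimensional $W$: the matrix entries of $\rho(\sigma)$ are polynomials in those of $\sigma$). Let $W$ carry a Hausdorff topology making it a topological vector space over $\mathbb C$ (the usual one if $\dim W<\infty$), and give the projective space $P(W)$ the quotient topology from $W\setminus\{0\}$. For a point $x\in P(W)$ let $\hat x\in W$ denote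 any nonzero vector on the line $x$. Call $w\in P(W)$ *generalized trace-like* if $\hat w$ is fixed by $T^k$, and call $h\in P(W)$ a *generalized permanent* if the stabilizer of $\hat h$ in $\tilde H^k$ is exactly $P^k$. Let $w\in P(W)$ be generalized trace-like and let $h\in P(W)$ be a generalized permanent. Then: (1) For every extension of $\rho$ to a representation $\bar\rho$ of the multiplicative monoid $(M_n(\mathbb C)\times M_n(\mathbb C))^k$ on $W$ that is again polynomial in the matrix entries (in the same sense), and for every $\sigma\in(M_n(\mathbb C)\times M_n(\mathbb C))^k$, one has $w^\sigma\ne h$; that is, $\bar\rho(\sigma)\hat w$ is not a nonzero multiple of $\hat h$. (2) $h$ does not lie in the orbit closure of $w$, i.e. in the closure in $P(W)$ of the orbit $\{\rho(\sigma)w : \sigma\in\tilde H^k\}$. -/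

import Mathlib

open scoped LinearAlgebra.Projectivization

namespace GenPerm

/-- `n × n` complex matrices. -/
abbrev Mat (n : ℕ) : Type := Matrix (Fin n) (Fin n) ℂ

/-- The group `SL_n(ℂ) × SL_n(ℂ)`. -/
abbrev SLPair (n : ℕ) : Type :=
  Matrix.SpecialLinearGroup (Fin n) ℂ × Matrix.SpecialLinearGroup (Fin n) ℂ

/-- The group `(SL_n(ℂ) × SL_n(ℂ))^k`. -/
abbrev SLPow (n k : ℕ) : Type := Fin k → SLPair n

/-- The monoid `(M_n(ℂ) × M_n(ℂ))^k`, with componentwise matrix multiplication. -/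
abbrev MatPow (n k : ℕ) : Type := Fin k → Mat n × Mat n

/-- The inclusion `(SL_n × SL_n)^k ⊆ (M_n × M_n)^k`. -/
def toMatPow {n k : ℕ} (σ : SLPow n k) : MatPow n k :=
  fun i => ((σ i).1.1, (σ i).2.1)

/-- Names for the `2 k n²` matrix entries of an element of `(M_n × M_n)^k`: the left summand
names the entries of the first factors, the right summand those of the second factors. -/
abbrev EntryVar (n k : ℕ) : Type := (Fin k × Fin n × Fin n) ⊕ (Fin k × Fin n × Fin n)

/-- The matrix entries of `σ ∈ (M_n × M_n)^k`. -/
def entries {n k : ℕ} (σ : MatPow n k) : EntryVar n k → ℂ :=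
  Sum.elim (fun a => (σ a.1).1 a.2.1 a.2.2) (fun a => (σ a.1).2 a.2.1 a.2.2)

section Representations

variable {n k : ℕ} {W : Type*} [AddCommGroup W] [Module ℂ W]

/-- `ρ` is a polynomial representation of `(SL_n × SL_n)^k`: every orbit map `σ ↦ ρ(σ) v` is a
polynomial in the matrix entries of `σ`, with finitely many coefficient vectors. If `W` has
finite dimension, this says that the matrix of `ρ(σ)` has polynomial entries; in general it says
that `W` is a union of such finite dimensional representations, as `ℂ[X₁, …, X_k]` is. -/
def IsPolynomialRep (ρ : Representation ℂ (SLPow n k) W) : Prop :=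
  ∀ v : W, ∃ (m : ℕ) (u : Fin m → W) (p : Fin m → MvPolynomial (EntryVar n k) ℂ),
    ∀ σ : SLPow n k, ρ σ v = ∑ i, MvPolynomial.eval (entries (toMatPow σ)) (p i) • u i

/-- `ρ'` extends `ρ` to `(M_n × M_n)^k`: it is multiplicative (a representation of that monoid),
polynomial in the matrix entries, and agrees with `ρ` on `(SL_n × SL_n)^k`. -/
structure IsPolynomialExtension (ρ : Representation ℂ (SLPow n k) W)
    (ρ' : Representation ℂ (MatPow n k) W) : Prop where
  polynomial : ∀ v : W, ∃ (m : ℕ) (u : Fin m → W)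
    (p : Fin m → MvPolynomial (EntryVar n k) ℂ),
      ∀ σ : MatPow n k, ρ' σ v = ∑ i, MvPolynomial.eval (entries σ) (p i) • u i
  extends_rep : ∀ σ : SLPow n k, ρ' (toMatPow σ) = ρ σ

/-- The stabilizer of a vector. -/
def vecStabilizer (ρ : Representation ℂ (SLPow n k) W) (v : W) : Subgroup (SLPow n k) where
  carrier := {σ | ρ σ v = v}
  one_mem' := by simp
  mul_mem' := by
    intro a b ha hb
    simp only [Set.mem_ofPred_eq] at ha hb ⊢
    rw [map_mul, Module.End.mul_apply, hb, ha]
  inv_mem' := by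
    intro a ha
    simp only [Set.mem_ofPred_eq] at ha ⊢
    nth_rewrite 1 [← ha]
    rw [← Module.End.mul_apply, ← map_mul, inv_mul_cancel, map_one, Module.End.one_apply]

end Representations

/-- The action of `SL_n × SL_n` on `M_n = ℂⁿ ⊗ ℂⁿ`, each factor acting on its copy of `ℂⁿ`:
`(A, B) · X = A X Bᵀ`. -/
def act {n : ℕ} (σ : SLPair n) (X : Mat n) : Mat n := σ.1.1 * X * σ.2.1.transpose

theorem act_one {n : ℕ} (X : Mat n) : act 1 X = X := by
  simp [act]

theorem act_mul {n : ℕ} (σ τ : SLPair n) (X : Mat n) : act (σ * τ) X = act σ (act τ X) := by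
  simp [act, Matrix.transpose_mul, Matrix.mul_assoc]

/-- The stabilizer in `SL_n × SL_n` of a function `f` of a variable `n × n` matrix. -/
def formStabilizer {n : ℕ} (f : Mat n → ℂ) : Subgroup (SLPair n) where
  carrier := {σ | ∀ X, f (act σ X) = f X}
  one_mem' := by
    intro X
    rw [act_one]
  mul_mem' := by
    intro a b ha hb X
    rw [act_mul, ha, hb]
  inv_mem' := by
    intro a ha X
    rw [← ha (act a⁻¹ X), ← act_mul, mul_inv_cancel, act_one]

/-- The stabilizer of the permanent in `SL_n × SL_n`. -/
def permSubgroup (n : ℕ) : Subgroup (SLPair n) :=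
  formStabilizer fun X => X.permanent

/-- `SL_n` embedded in `SL_n × SL_n` by `A ↦ (A, (A⁻¹)ᵀ)`. These are the pairs that act on
`n × n` matrices by the conjugations `X ↦ A X A⁻¹`. -/
def traceSubgroup (n : ℕ) : Subgroup (SLPair n) where
  carrier := {σ | σ.2 = (σ.1⁻¹).transpose}
  one_mem' := by
    apply Subtype.ext
    simp
  mul_mem' := by
    intro a b ha hb
    simp only [Set.mem_ofPred_eq, Prod.fst_mul, Prod.snd_mul] at ha hb ⊢
    rw [ha, hb]
    apply Subtype.ext
    simp [Matrix.transpose_mul]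
  inv_mem' := by
    intro a ha
    simp only [Set.mem_ofPred_eq, Prod.fst_inv, Prod.snd_inv] at ha ⊢
    rw [ha, inv_inv]
    apply inv_eq_of_mul_eq_one_right
    apply Subtype.ext
    simp [← Matrix.transpose_mul, Matrix.mul_adjugate]

/-- The `k`-fold power `K^k` of a subgroup `K` of `SL_n × SL_n`. -/
def powSubgroup {n : ℕ} (k : ℕ) (K : Subgroup (SLPair n)) : Subgroup (SLPow n k) :=
  Subgroup.pi Set.univ fun _ => K

section Points

variable {n k : ℕ} {W : Type*} [AddCommGroup W] [Module ℂ W]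

/-- A point of `P(W)` is generalized trace-like if a nonzero vector on the line (equivalently,
each of them) is fixed by the `k`-th power of the embedded `SL_n`. -/
def IsGenTraceLike (ρ : Representation ℂ (SLPow n k) W) (w : ℙ ℂ W) : Prop :=
  powSubgroup k (traceSubgroup n) ≤ vecStabilizer ρ w.rep

/-- A point of `P(W)` is a generalized permanent if the stabilizer of a nonzero vector on the
line (equivalently, of each of them) is exactly the `k`-th power of the stabilizer of the
permanent. -/
def IsGenPermanent (ρ : Representation ℂ (SLPow n k) W) (h : ℙ ℂ W) : Prop :=
  vecStabilizer ρ h.rep = powSubgroup k (permSubgroup n)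

/-- The orbit of `w ∈ P(W)` under `(SL_n × SL_n)^k`. -/
def orbit (ρ : Representation ℂ (SLPow n k) W) (w : ℙ ℂ W) : Set (ℙ ℂ W) :=
  {x | ∃ (σ : SLPow n k) (hv : ρ σ w.rep ≠ 0), x = Projectivization.mk ℂ (ρ σ w.rep) hv}

/-- The topology of the projective space `P(W)`: the quotient topology of `W ∖ {0}`. -/
@[reducible]
noncomputable def projTopology (W : Type*) [AddCommGroup W] [Module ℂ W] [TopologicalSpace W] :
    TopologicalSpace (ℙ ℂ W) :=
  TopologicalSpace.coinduced (fun v : {v : W // v ≠ 0} => Projectivization.mk ℂ v.1 v.2)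
    inferInstance

/-- The orbit closure of `w` in `P(W)`. -/
def orbitClosure [TopologicalSpace W] (ρ : Representation ℂ (SLPow n k) W) (w : ℙ ℂ W) :
    Set (ℙ ℂ W) :=
  @closure _ (projTopology W) (orbit ρ w)

end Points

end GenPerm

/-! The obstruction is a one-parameter unipotent group `(1 + tM, 1 + tN)` with `M² = N² = 0` and
`(M, N) ≠ 0`, placed in one of the `k` factors. Every vector reached from `w` is fixed by such a
group, whereas the stabilizer of the permanent contains none.

For the first claim, let `(A, B)` be a component of `σ`. If `A` and `B` are invertible, the
unipotents of the trace subgroup are conjugated by `(A, B)`; if one is singular, it absorbs some `1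
+ tM` from the left (`exists_intertwining_pair`). For the second, differentiating the permanent at a
suitable matrix shows that `M` and `N` are diagonal, hence zero (`off_diag_eq_zero_of_permanent`).

Being fixed by such a group survives limits: rescaling `t` normalizes `(M, N)` into a compact set,
and projection along a compact factor is closed (`IsPolynomialRep.isClosed_fixedByUnipotents`). This
settles the orbit closure. -/

namespace GenPerm

open Matrix

/-! ### Unipotents from square zero matrices -/

section SquareZero

/-- Pairs of square zero matrices. -/
abbrev SquareZeroPair (n : ℕ) : Type :=
  {κ : Mat n × Mat n // κ.1 * κ.1 = 0 ∧ κ.2 * κ.2 = 0}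

/-- The polynomial `det (1 - X M)` is a unit of `ℂ[X]`, hence constant; its values at `0` and `-1`
are compared. -/
theorem det_one_add_of_isNilpotent {n : ℕ} {M : Mat n} (hM : IsNilpotent M) :
    (1 + M).det = 1 := by
  have hu := Matrix.isUnit_charpolyRev_of_isNilpotent hM
  obtain ⟨c, -, hc⟩ := Polynomial.isUnit_iff.mp hu
  have h0 : M.charpolyRev.eval 0 = 1 := Matrix.eval_charpolyRev
  have h1 : M.charpolyRev.eval (-1) = (1 + M).det := by
    rw [Matrix.charpolyRev, ← Polynomial.coe_evalRingHom, RingHom.map_det]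
    congr 1
    ext i j
    simp [Matrix.one_apply, apply_ite (Polynomial.eval (-1 : ℂ))]
  rw [← h1, ← h0, ← hc, Polynomial.eval_C, Polynomial.eval_C]

theorem det_one_add_smul {n : ℕ} {M : Mat n} (hM : M * M = 0) (t : ℂ) :
    (1 + t • M).det = 1 :=
  det_one_add_of_isNilpotent ⟨2, by simp [pow_two, hM]⟩

/-- The pair `(1 + t M, 1 + t N)` in `SL_n × SL_n`, where `M` and `N` have square zero. -/
def unipotentPair {n : ℕ} (κ : SquareZeroPair n) (t : ℂ) :
    SLPair n :=
  (⟨1 + t • κ.1.1, det_one_add_smul κ.2.1 t⟩, ⟨1 + t • κ.1.2, det_one_add_smul κ.2.2 t⟩)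

end SquareZero

/-! ### Unipotents preserving the permanent -/

section Permanent

theorem continuous_permanent {n : ℕ} : Continuous (fun X : Mat n => X.permanent) := by
  unfold Matrix.permanent
  fun_prop

/-- A matrix whose rows other than `i, j` are those of the identity and whose `i`-th row agrees in
positions `i, j` has only two permutations contributing to its permanent. -/
theorem permanent_eq_two_mul {n : ℕ} {i j : Fin n} (hij : i ≠ j) {Y : Mat n} {a : ℂ}
    (hii : Y i i = a) (hi : Y i j = a) (hji : Y j i = 1) (hjj : Y j j = 1)
    (hj : ∀ c, c ≠ i → c ≠ j → Y j c = 0)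
    (hl : ∀ l, l ≠ i → l ≠ j → ∀ c, c ≠ l → Y l c = 0)
    (hl1 : ∀ l, l ≠ i → l ≠ j → Y l l = 1) : Y.permanent = 2 * a := by
  have key : ∀ π : Equiv.Perm (Fin n), (∀ l, Y l (π l) ≠ 0) → π = 1 ∨ π = Equiv.swap i j := by
    intro π hπ
    have hfix : ∀ l, l ≠ i → l ≠ j → π l = l := by
      intro l h1 h2
      by_contra h3
      exact hπ l (hl l h1 h2 _ h3)
    have hpj : π j = i ∨ π j = j := by
      by_contra! h3
      exact hπ j (hj _ h3.1 h3.2)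
    have hpi : π i = i ∨ π i = j := by
      by_contra! h3
      exact h3.1 (π.injective (hfix _ h3.1 h3.2))
    rcases hpj with h1 | h1
    · right
      have h2 : π i = j := hpi.resolve_left fun h => hij (π.injective (h.trans h1.symm))
      ext l
      by_cases hli : l = i
      · subst hli; rw [h2, Equiv.swap_apply_left]
      by_cases hlj : l = j
      · subst hlj; rw [h1, Equiv.swap_apply_right]
      rw [hfix l hli hlj, Equiv.swap_apply_of_ne_of_ne hli hlj]
    · left
      have h2 : π i = i := hpi.resolve_right fun h => hij (π.injective (h.trans h1.symm))
      ext l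
      by_cases hli : l = i
      · subst hli; rw [h2]; rfl
      by_cases hlj : l = j
      · subst hlj; rw [h1]; rfl
      rw [hfix l hli hlj]; rfl
  have hne : (1 : Equiv.Perm (Fin n)) ≠ Equiv.swap i j := by
    intro h
    have := congrArg (fun π : Equiv.Perm (Fin n) => π i) h
    simp at this
    exact hij this
  have hprod : ∀ π : Equiv.Perm (Fin n), Y i (π i) = a → Y j (π j) = 1 →
      (∀ l, l ≠ i → l ≠ j → π l = l) → ∏ l, Y l (π l) = a := by
    intro π h1 h2 h3
    rw [Finset.prod_eq_single i, h1]
    · intro l _ hli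
      by_cases hlj : l = j
      · subst hlj; exact h2
      · rw [h3 l hli hlj, hl1 l hli hlj]
    · simp
  -- `Matrix.permanent` lets the permutation act on row indices; transposing moves it to the
  -- columns.
  rw [← Matrix.permanent_transpose, Matrix.permanent]
  simp only [Matrix.transpose_apply]
  rw [← Finset.sum_subset (Finset.subset_univ {1, Equiv.swap i j}), Finset.sum_pair hne,
    hprod 1 (by simpa using hii) (by simpa using hjj) (by simp),
    hprod (Equiv.swap i j) (by simpa using hi) (by simpa using hji)
      (fun l => Equiv.swap_apply_of_ne_of_ne), two_mul]
  intro π _ hπ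
  by_contra h
  have := key π fun l => Finset.prod_ne_zero_iff.mp h l (Finset.mem_univ l)
  simp at hπ
  tauto

/-- A derivative at `t = 0`. The test matrix `X` has zero row `i`, row `j` equal to `e_i + e_j`, and
identity rows elsewhere. Row `i` of `(1 + tM)X` is `t` times row `i` of `MX`, so a factor `t` leaves
the permanent; cancelling it and letting `t → 0` gives the permanent of `X` with row `i` replaced by
that of `MX`. Its two surviving terms both equal `M i j`; for the determinant they would cancel. -/
theorem off_diag_eq_zero_of_permanent {n : ℕ} {M N : Mat n}
    (h : ∀ (t : ℂ) (X : Mat n),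
      ((1 + t • M) * X * (1 + t • N)ᵀ).permanent = X.permanent)
    {i j : Fin n} (hij : i ≠ j) : M i j = 0 := by
  set X : Mat n := Matrix.of fun l c =>
    if l = i then 0 else if l = j then (if c = i ∨ c = j then 1 else 0)
      else if c = l then 1 else 0 with hX
  have hXi : X i = 0 := by ext c; simp [hX]
  have hX0 : X.permanent = 0 := by
    have : X = X.updateRow i ((0 : ℂ) • X i) := by
      ext l c
      by_cases hl : l = i
      · subst hl; simp [hXi]
      · simp [hl]
    rw [this, Matrix.permanent_updateRow_smul, zero_mul]
  let Y : ℂ → Mat n := fun t =>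
    (((1 + t • M) * X).updateRow i ((M * X) i)) * (1 + t • N)ᵀ
  have hY : ∀ t, (1 + t • M) * X * (1 + t • N)ᵀ = (Y t).updateRow i (t • (Y t) i) := by
    intro t
    ext l c
    by_cases hl : l = i
    · subst hl
      simp only [Y, Matrix.updateRow_self, Pi.smul_apply, Matrix.mul_apply, smul_eq_mul,
        Finset.mul_sum]
      refine Finset.sum_congr rfl fun d _ => ?_
      have : ∑ x, (1 + t • M) l x * X x d = t * ∑ x, M l x * X x d := by
        rw [← Matrix.mul_apply, add_mul, one_mul, smul_mul_assoc, Matrix.add_apply, hXi,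
          Matrix.smul_apply, Matrix.mul_apply]
        simp
      rw [this]; ring
    · simp only [Y, Matrix.updateRow_ne hl, Matrix.mul_apply]
  have hYt : ∀ t, t ≠ 0 → (Y t).permanent = 0 := by
    intro t ht
    have h1 := h t X
    rw [hY, Matrix.permanent_updateRow_smul, hX0, Matrix.updateRow_eq_self] at h1
    exact (mul_eq_zero.mp h1).resolve_left ht
  have hcont : Continuous fun t => (Y t).permanent := by
    refine continuous_permanent.comp ?_
    refine continuous_matrix fun l c => ?_
    by_cases hl : l = i
    · subst hl
      simp only [Y, Matrix.mul_apply, Matrix.updateRow_self, Matrix.transpose_apply,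
        Matrix.add_apply, Matrix.smul_apply]
      fun_prop
    · simp only [Y, Matrix.mul_apply, Matrix.updateRow_ne hl, Matrix.transpose_apply,
        Matrix.add_apply, Matrix.smul_apply]
      fun_prop
  have hY0 : (Y 0).permanent = 0 := by
    have : (fun t => (Y t).permanent) = fun _ => 0 :=
      Continuous.ext_on (dense_compl_singleton (0 : ℂ)) hcont continuous_const
        fun t ht => hYt t ht
    exact congrFun this 0
  have hY0' : Y 0 = X.updateRow i ((M * X) i) := by simp [Y]
  have hMX : ∀ c, (c = i ∨ c = j) → (M * X) i c = M i j := by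
    intro c hc
    rw [Matrix.mul_apply, Finset.sum_eq_single j]
    · simp [hX, hij.symm, hc]
    · intro l _ hlj
      have : c = l → l = i := by
        rintro rfl
        tauto
      simp only [hX, Matrix.of_apply, hlj, if_false]
      split_ifs with h1 h2
      · simp
      · exact absurd (this h2) h1
      · simp
    · simp
  have h2 : (Y 0).permanent = 2 * M i j := by
    rw [hY0']
    refine permanent_eq_two_mul hij ?_ ?_ ?_ ?_ ?_ ?_ ?_
    · simpa using hMX i (Or.inl rfl)
    · simpa using hMX j (Or.inr rfl)
    · simp [hX, hij.symm]
    · simp [hX, hij.symm]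
    · intro c h1 h2
      simp [hX, hij.symm, h1, h2]
    · intro l h1 h2 c hc
      simp [hX, h1, h2, hc]
    · intro l h1 h2
      simp [hX, h1, h2]
  rw [h2] at hY0
  simpa using hY0

theorem eq_zero_of_mul_self_of_off_diag {n : ℕ} {M : Mat n} (hM : M * M = 0)
    (h : ∀ i j, i ≠ j → M i j = 0) : M = 0 := by
  ext i j
  by_cases hij : i = j
  · subst hij
    have h1 := congrFun (congrFun hM i) i
    rw [Matrix.mul_apply, Finset.sum_eq_single i] at h1
    · simpa using h1
    · intro l _ hl
      rw [h i l hl.symm, zero_mul]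
    · simp
  · exact h i j hij

/-- A one-parameter group of unipotent pairs generated by square zero matrices preserves the
permanent only if it is trivial. -/
theorem eq_zero_of_unipotentPair_mem_permSubgroup {n : ℕ}
    (κ : SquareZeroPair n)
    (h : ∀ t, unipotentPair κ t ∈ permSubgroup n) : κ.1 = 0 := by
  have h1 : ∀ (t : ℂ) (X : Mat n),
      ((1 + t • κ.1.1) * X * (1 + t • κ.1.2)ᵀ).permanent = X.permanent := fun t X => h t X
  -- Transposition preserves the permanent and exchanges the two factors.
  have h2 : ∀ (t : ℂ) (X : Mat n),
      ((1 + t • κ.1.2) * X * (1 + t • κ.1.1)ᵀ).permanent = X.permanent := by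
    intro t X
    rw [← Matrix.permanent_transpose, Matrix.transpose_mul, Matrix.transpose_mul,
      Matrix.transpose_transpose, ← Matrix.mul_assoc, h1, Matrix.permanent_transpose]
  exact Prod.ext
    (eq_zero_of_mul_self_of_off_diag κ.2.1 fun i j => off_diag_eq_zero_of_permanent h1)
    (eq_zero_of_mul_self_of_off_diag κ.2.2 fun i j => off_diag_eq_zero_of_permanent h2)

end Permanent

/-! ### Moving unipotents past a matrix pair -/

section Intertwining

theorem toMatPow_mul {n k : ℕ} (σ τ : SLPow n k) :
    toMatPow (σ * τ) = toMatPow σ * toMatPow τ := rfl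

theorem toMatPow_injective {n k : ℕ} : Function.Injective (toMatPow (n := n) (k := k)) := by
  intro σ τ h
  funext i
  have := congrFun h i
  exact Prod.ext (Subtype.ext (congrArg Prod.fst this)) (Subtype.ext (congrArg Prod.snd this))

/-- A singular matrix of size at least two is annihilated from the left by a nonzero matrix of
square zero. -/
theorem exists_mul_eq_zero_of_det_eq_zero {n : ℕ} (hn : 2 ≤ n) {A : Mat n} (hA : A.det = 0) :
    ∃ M : Mat n, M ≠ 0 ∧ M * M = 0 ∧ M * A = 0 := by
  obtain ⟨v, hv, hvA⟩ := Matrix.exists_vecMul_eq_zero_iff.mpr hA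
  -- The witness is the rank one matrix `u vᵀ`: `v A = 0` makes it annihilate `A`, and `v ⬝ᵥ u = 0`
  -- makes its square vanish. A nonzero such `u` exists because `n ≥ 2`.
  obtain ⟨u, hu, hvu⟩ : ∃ u : Fin n → ℂ, u ≠ 0 ∧ v ⬝ᵥ u = 0 := by
    let a : Fin n := ⟨0, by omega⟩
    let b : Fin n := ⟨1, by omega⟩
    have hab : a ≠ b := by simp [a, b]
    by_cases h : v a = 0
    · exact ⟨Pi.single a 1, by simp, by simp [h]⟩
    · refine ⟨Pi.single a (v b) - Pi.single b (v a), fun h0 => h ?_, ?_⟩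
      · simpa [hab.symm] using congrFun h0 b
      · simp [dotProduct_sub, mul_comm]
  refine ⟨vecMulVec u v, ?_, ?_, ?_⟩
  · obtain ⟨i, hi⟩ := Function.ne_iff.mp hu
    obtain ⟨j, hj⟩ := Function.ne_iff.mp hv
    intro h
    have := congrFun (congrFun h i) j
    rw [vecMulVec_apply] at this
    exact mul_ne_zero hi hj this
  · rw [vecMulVec_mul_vecMulVec, hvu]
    simp
  · rw [vecMulVec_mul, hvA]
    ext; simp [vecMulVec_apply]

/-- Applied to a vector fixed by `τ`, the intertwining shows that its image under `(A, B)` is fixed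
by the unipotent pair. Singular factors are covered by `τ = 1`. -/
theorem exists_intertwining_pair {n : ℕ} (hn : 2 ≤ n) (A B : Mat n) :
    ∃ κ : SquareZeroPair n, κ.1 ≠ 0 ∧ ∀ t, ∃ τ ∈ traceSubgroup n,
      (unipotentPair κ t).1.1 * A = A * τ.1.1 ∧ (unipotentPair κ t).2.1 * B = B * τ.2.1 := by
  by_cases hA : A.det = 0
  · obtain ⟨M, hM, hMM, hMA⟩ := exists_mul_eq_zero_of_det_eq_zero hn hA
    refine ⟨⟨(M, 0), hMM, zero_mul 0⟩, fun h => hM (congrArg Prod.fst h), fun t =>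
      ⟨1, one_mem _, ?_, ?_⟩⟩
    · simp [unipotentPair, add_mul, hMA]
    · simp [unipotentPair]
  by_cases hB : B.det = 0
  · obtain ⟨M, hM, hMM, hMB⟩ := exists_mul_eq_zero_of_det_eq_zero hn hB
    refine ⟨⟨(0, M), zero_mul 0, hMM⟩, fun h => hM (congrArg Prod.snd h), fun t =>
      ⟨1, one_mem _, ?_, ?_⟩⟩
    · simp [unipotentPair]
    · simp [unipotentPair, add_mul, hMB]
  have hA' : A⁻¹ * A = 1 := Matrix.nonsing_inv_mul A (Ne.isUnit hA)
  have hB' : B⁻¹ * B = 1 := Matrix.nonsing_inv_mul B (Ne.isUnit hB)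
  obtain ⟨E, hE, hEE⟩ : ∃ E : Mat n, E ≠ 0 ∧ E * E = 0 := by
    obtain ⟨E, hE, hEE, -⟩ := exists_mul_eq_zero_of_det_eq_zero hn (A := 0)
      (by have : Nonempty (Fin n) := ⟨⟨0, by omega⟩⟩; exact Matrix.det_zero)
    exact ⟨E, hE, hEE⟩
  have hEt : Eᵀ * Eᵀ = 0 := by rw [← Matrix.transpose_mul, hEE, Matrix.transpose_zero]
  have conj : ∀ {C F : Mat n}, C⁻¹ * C = 1 → F * F = 0 →
      (C * F * C⁻¹) * (C * F * C⁻¹) = 0 := by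
    intro C F hC hF
    calc _ = C * F * (C⁻¹ * C) * F * C⁻¹ := by simp only [Matrix.mul_assoc]
      _ = C * (F * F) * C⁻¹ := by rw [hC, Matrix.mul_one, Matrix.mul_assoc C F F]
      _ = 0 := by rw [hF]; simp
  have conj' : ∀ {C F : Mat n}, C⁻¹ * C = 1 → C * F * C⁻¹ * C = C * F := by
    intro C F hC
    rw [Matrix.mul_assoc, hC, Matrix.mul_one]
  -- The conjugate by `(A, B)` of `(E, -Eᵀ)`, which generates the subgroup `(1 + tE, ((1 + tE)⁻¹)ᵀ)`
  -- of the trace subgroup.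
  refine ⟨⟨(A * E * A⁻¹, -(B * Eᵀ * B⁻¹)), conj hA' hEE, ?_⟩, ?_, ?_⟩
  · rw [neg_mul_neg]; exact conj hB' hEt
  · intro h
    have h1 : A * E * A⁻¹ = 0 := congrArg Prod.fst h
    apply hE
    calc E = (A⁻¹ * A) * E * (A⁻¹ * A) := by simp [hA']
      _ = A⁻¹ * (A * E * A⁻¹) * A := by simp only [Matrix.mul_assoc]
      _ = 0 := by rw [h1]; simp
  · intro t
    let S : SpecialLinearGroup (Fin n) ℂ := ⟨1 + t • E, det_one_add_smul hEE t⟩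
    let S' : SpecialLinearGroup (Fin n) ℂ := ⟨1 + (-t) • E, det_one_add_smul hEE (-t)⟩
    have hS : S⁻¹ = S' := by
      apply inv_eq_of_mul_eq_one_right
      apply Subtype.ext
      change (1 + t • E) * (1 + (-t) • E) = 1
      simp [add_mul, mul_add, hEE]
    refine ⟨(S, (S⁻¹).transpose), rfl, ?_, ?_⟩
    · change (1 + t • (A * E * A⁻¹)) * A = A * (1 + t • E)
      rw [add_mul, mul_add, smul_mul_assoc, conj' hA', mul_smul_comm, one_mul, mul_one]
    · rw [hS]
      change (1 + t • (-(B * Eᵀ * B⁻¹))) * B = B * (1 + (-t) • E)ᵀ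
      rw [add_mul, smul_mul_assoc, neg_mul, conj' hB']
      simp [mul_add]

theorem exists_intertwining {n k : ℕ} (hn : 2 ≤ n) (i : Fin k) (σ : MatPow n k) :
    ∃ κ : SquareZeroPair n, κ.1 ≠ 0 ∧ ∀ t, ∃ τ ∈ powSubgroup k (traceSubgroup n),
      toMatPow (Pi.mulSingle i (unipotentPair κ t)) * σ = σ * toMatPow τ := by
  obtain ⟨κ, hκ, h⟩ := exists_intertwining_pair hn (σ i).1 (σ i).2
  refine ⟨κ, hκ, fun t => ?_⟩
  obtain ⟨τ, hτ, h1, h2⟩ := h t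
  refine ⟨Pi.mulSingle i τ, ?_, ?_⟩
  · refine Subgroup.mem_pi Set.univ |>.mpr fun j _ => ?_
    by_cases hj : j = i
    · subst hj; simpa using hτ
    · rw [Pi.mulSingle_eq_of_ne hj]; exact one_mem _
  · funext j
    by_cases hj : j = i
    · subst hj
      simp only [toMatPow, Pi.mul_apply, Pi.mulSingle_eq_same]
      exact Prod.ext h1 h2
    · simp only [toMatPow, Pi.mul_apply, Pi.mulSingle_eq_of_ne hj]
      exact (one_mul (σ j)).trans (mul_one (σ j)).symm

end Intertwining

/-! ### Vectors fixed by unipotents -/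

section Representations

variable {n k : ℕ} {W : Type*} [AddCommGroup W] [Module ℂ W]

/-- The one-parameter group of unipotent pairs given by `κ`, placed in the `i`-th factor, fixes
the vector `v`. -/
def FixedByUnipotents (ρ : Representation ℂ (SLPow n k) W) (i : Fin k) (κ : SquareZeroPair n)
    (v : W) : Prop :=
  ∀ t, ρ (Pi.mulSingle i (unipotentPair κ t)) v = v

theorem IsGenPermanent.eq_zero_of_fixedByUnipotents {ρ : Representation ℂ (SLPow n k) W}
    {h : ℙ ℂ W} (hh : IsGenPermanent ρ h) {i : Fin k} {κ : SquareZeroPair n}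
    (hκ : FixedByUnipotents ρ i κ h.rep) : κ.1 = 0 := by
  refine eq_zero_of_unipotentPair_mem_permSubgroup κ fun t => ?_
  have h1 : Pi.mulSingle i (unipotentPair κ t) ∈ powSubgroup k (permSubgroup n) := hh ▸ hκ t
  simpa using (Subgroup.mem_pi Set.univ).mp h1 i (Set.mem_univ i)

theorem FixedByUnipotents.smul {ρ : Representation ℂ (SLPow n k) W} {i : Fin k}
    {κ : SquareZeroPair n} {v : W} (hv : FixedByUnipotents ρ i κ v) (c : ℂ) :
    FixedByUnipotents ρ i κ (c • v) := fun t => by rw [map_smul, hv t]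

theorem FixedByUnipotents.rep_mk {ρ : Representation ℂ (SLPow n k) W} {i : Fin k}
    {κ : SquareZeroPair n} {v : W} (hv : FixedByUnipotents ρ i κ v) (h0 : v ≠ 0) :
    FixedByUnipotents ρ i κ (Projectivization.mk ℂ v h0).rep := by
  obtain ⟨a, ha⟩ := Projectivization.exists_smul_eq_mk_rep ℂ v h0
  rw [← ha]
  exact hv.smul (a : ℂ)

/-- The scalar is absorbed into the parameter `t`, so generators may be normalized. -/
theorem FixedByUnipotents.scale {ρ : Representation ℂ (SLPow n k) W} {i : Fin k}
    {κ κ' : SquareZeroPair n} {v : W} (hv : FixedByUnipotents ρ i κ v) {c : ℂ}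
    (h : κ'.1 = c • κ.1) : FixedByUnipotents ρ i κ' v := by
  intro t
  have : unipotentPair κ' t = unipotentPair κ (t * c) := by
    apply Prod.ext <;> apply Subtype.ext <;> simp [unipotentPair, h, smul_smul]
  rw [this]
  exact hv _

theorem IsGenTraceLike.exists_fixedByUnipotents_extension (hn : 2 ≤ n)
    {ρ : Representation ℂ (SLPow n k) W} {w : ℙ ℂ W} (hw : IsGenTraceLike ρ w)
    {ρ' : Representation ℂ (MatPow n k) W} (hρ' : IsPolynomialExtension ρ ρ')
    (i : Fin k) (σ : MatPow n k) :
    ∃ κ : SquareZeroPair n, κ.1 ≠ 0 ∧ FixedByUnipotents ρ i κ (ρ' σ w.rep) := by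
  obtain ⟨κ, hκ, h⟩ := exists_intertwining hn i σ
  refine ⟨κ, hκ, fun t => ?_⟩
  obtain ⟨τ, hτ, h1⟩ := h t
  have h2 : ρ τ w.rep = w.rep := hw hτ
  rw [← hρ'.extends_rep, ← Module.End.mul_apply, ← map_mul, h1, map_mul, Module.End.mul_apply,
    hρ'.extends_rep, h2]

theorem IsGenTraceLike.exists_fixedByUnipotents (hn : 2 ≤ n)
    {ρ : Representation ℂ (SLPow n k) W} {w : ℙ ℂ W} (hw : IsGenTraceLike ρ w)
    (i : Fin k) (σ : SLPow n k) :
    ∃ κ : SquareZeroPair n, κ.1 ≠ 0 ∧ FixedByUnipotents ρ i κ (ρ σ w.rep) := by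
  obtain ⟨κ, hκ, h⟩ := exists_intertwining hn i (toMatPow σ)
  refine ⟨κ, hκ, fun t => ?_⟩
  obtain ⟨τ, hτ, h1⟩ := h t
  have h2 : ρ τ w.rep = w.rep := hw hτ
  rw [← toMatPow_mul, ← toMatPow_mul] at h1
  rw [← Module.End.mul_apply, ← map_mul, toMatPow_injective h1, map_mul, Module.End.mul_apply, h2]

end Representations

/-! ### Passage to the orbit closure -/

section Topology

variable {n k : ℕ} {W : Type*} [AddCommGroup W] [Module ℂ W]

theorem continuous_entries_unipotentPair (i : Fin k) (t : ℂ) :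
    Continuous fun κ : SquareZeroPair n =>
      entries (toMatPow (Pi.mulSingle i (unipotentPair κ t) : SLPow n k)) := by
  refine continuous_pi fun x => ?_
  rcases x with ⟨j, a, b⟩ | ⟨j, a, b⟩
  all_goals
    simp only [entries, toMatPow, Sum.elim_inl, Sum.elim_inr]
    by_cases hj : j = i
    · subst hj
      simp only [Pi.mulSingle_eq_same, unipotentPair, Matrix.add_apply, Matrix.smul_apply]
      fun_prop
    · simp only [Pi.mulSingle_eq_of_ne hj]
      exact continuous_const

/-- Every nonzero pair of square zero matrices can be scaled into a compact set of such pairs. -/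
theorem exists_compact_normalized (n : ℕ) :
    ∃ K : Set (SquareZeroPair n), IsCompact K ∧ (∀ κ ∈ K, κ.1 ≠ 0) ∧
      ∀ κ : SquareZeroPair n, κ.1 ≠ 0 → ∃ κ' ∈ K, ∃ c : ℂ, κ'.1 = c • κ.1 := by
  let : NormedAddCommGroup (Mat n) := Matrix.normedAddCommGroup
  let : NormedSpace ℂ (Mat n) := Matrix.normedSpace
  have : ProperSpace (Mat n) := FiniteDimensional.proper ℂ _
  have hclosed : IsClosed {κ : Mat n × Mat n | κ.1 * κ.1 = 0 ∧ κ.2 * κ.2 = 0} :=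
    (isClosed_eq (by fun_prop) continuous_const).inter
      (isClosed_eq (by fun_prop) continuous_const)
  refine ⟨Subtype.val ⁻¹' Metric.sphere (0 : Mat n × Mat n) 1,
    hclosed.isClosedEmbedding_subtypeVal.isCompact_preimage (isCompact_sphere _ _), ?_, ?_⟩
  · intro κ hκ h0
    simp [h0] at hκ
  · intro κ hκ
    refine ⟨⟨((‖κ.1‖⁻¹ : ℝ) : ℂ) • κ.1, ?_, ?_⟩, ?_, _, rfl⟩
    · simp [κ.2.1]
    · simp [κ.2.2]
    · have : ‖κ.1‖ ≠ 0 := norm_ne_zero_iff.mpr hκ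
      rw [Set.mem_preimage, mem_sphere_zero_iff_norm, norm_smul, Complex.norm_real, norm_inv,
        norm_norm, inv_mul_cancel₀ this]

variable [TopologicalSpace W] [IsTopologicalAddGroup W] [ContinuousSMul ℂ W] [T2Space W]

/-- On a finite dimensional `V` the coordinates are continuous, so joint continuity reduces to the
polynomial orbit maps of basis vectors. No continuity of `ρ σ` on all of `W` is needed. -/
theorem IsPolynomialRep.continuous_unipotents {ρ : Representation ℂ (SLPow n k) W}
    (hρ : IsPolynomialRep ρ) (i : Fin k) (t : ℂ) (V : Submodule ℂ W) [FiniteDimensional ℂ V] :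
    Continuous fun x : SquareZeroPair n × V =>
      ρ (Pi.mulSingle i (unipotentPair x.1 t)) (x.2 : W) := by
  let b := Module.finBasis ℂ V
  have hb : ∀ v : V, (v : W) = ∑ j, b.coord j v • (b j : W) := by
    intro v
    conv_lhs => rw [← b.sum_repr v]
    simp only [Submodule.coe_sum, Submodule.coe_smul, Module.Basis.coord_apply]
  have h1 : (fun x : SquareZeroPair n × V =>
      ρ (Pi.mulSingle i (unipotentPair x.1 t)) (x.2 : W)) =
      fun x => ∑ j, b.coord j x.2 • ρ (Pi.mulSingle i (unipotentPair x.1 t)) (b j : W) := by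
    funext x
    rw [hb x.2, map_sum]
    simp only [map_smul]
  rw [h1]
  refine continuous_finsetSum _ fun j _ => Continuous.smul ?_ ?_
  · exact (LinearMap.continuous_of_finiteDimensional (b.coord j)).comp continuous_snd
  · obtain ⟨m, u, p, hp⟩ := hρ (b j : W)
    simp only [hp]
    refine continuous_finsetSum _ fun l _ => Continuous.smul ?_ continuous_const
    exact (MvPolynomial.continuous_eval (p l)).comp
      ((continuous_entries_unipotentPair i t).comp continuous_fst)

/-- The set is the image of a closed subset of `K × V` under projection to `V`, a closed map since
`K` is compact; and `V` is closed in the Hausdorff space `W`. -/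
theorem IsPolynomialRep.isClosed_fixedByUnipotents {ρ : Representation ℂ (SLPow n k) W}
    (hρ : IsPolynomialRep ρ) (i : Fin k) {K : Set (SquareZeroPair n)} (hK : IsCompact K)
    (V : Submodule ℂ W) [FiniteDimensional ℂ V] :
    IsClosed {v : W | v ∈ V ∧ ∃ κ ∈ K, FixedByUnipotents ρ i κ v} := by
  have : CompactSpace K := isCompact_iff_compactSpace.mp hK
  have hV : IsClosed (V : Set W) := V.closed_of_finiteDimensional
  have h1 : IsClosed {x : K × V | FixedByUnipotents ρ i x.1.1 (x.2 : W)} := by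
    simp only [FixedByUnipotents, Set.ofPred_forall]
    refine isClosed_iInter fun t => isClosed_eq ?_ (by fun_prop)
    exact (hρ.continuous_unipotents i t V).comp
      (f := fun x : K × V => ((x.1 : SquareZeroPair n), x.2)) (by fun_prop)
  have h2 := hV.isClosedEmbedding_subtypeVal.isClosedMap _
    (isClosedMap_snd_of_compactSpace _ h1)
  convert h2 using 1
  ext v
  constructor
  · rintro ⟨hv, κ, hκ, h⟩
    exact ⟨⟨v, hv⟩, ⟨(⟨κ, hκ⟩, ⟨v, hv⟩), h, rfl⟩, rfl⟩
  · rintro ⟨_, ⟨⟨κ, v⟩, h, rfl⟩, rfl⟩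
    exact ⟨v.2, κ.1, κ.2, h⟩

theorem IsGenTraceLike.exists_fixedByUnipotents_of_mem_orbitClosure (hn : 2 ≤ n)
    {ρ : Representation ℂ (SLPow n k) W} (hρ : IsPolynomialRep ρ) {w h : ℙ ℂ W}
    (hw : IsGenTraceLike ρ w) (i : Fin k) (hh : h ∈ orbitClosure ρ w) :
    ∃ κ : SquareZeroPair n, κ.1 ≠ 0 ∧ FixedByUnipotents ρ i κ h.rep := by
  obtain ⟨K, hK, hK0, hKs⟩ := exists_compact_normalized n
  obtain ⟨m, u, p, hp⟩ := hρ w.rep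
  -- The coefficient vectors of the orbit map of `w` span a finite dimensional space containing the
  -- whole orbit.
  let V : Submodule ℂ W := Submodule.span ℂ (Set.range u)
  have : FiniteDimensional ℂ V := FiniteDimensional.span_of_finite ℂ (Set.finite_range u)
  let Z : Set W := {v : W | v ∈ V ∧ ∃ κ ∈ K, FixedByUnipotents ρ i κ v}
  have hZ : IsClosed Z := hρ.isClosed_fixedByUnipotents i hK V
  -- `Z` is a cone, so membership depends only on the line and defines a closed subset of `P(W)`.
  have hZs : ∀ (c : ℂ) (v : W), v ∈ Z → c • v ∈ Z := by
    rintro c v ⟨hv, κ, hκ, hf⟩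
    exact ⟨V.smul_mem c hv, κ, hκ, hf.smul c⟩
  have hZmk : ∀ (v : W) (hv : v ≠ 0), (Projectivization.mk ℂ v hv).rep ∈ Z ↔ v ∈ Z := by
    intro v hv
    obtain ⟨a, ha⟩ := Projectivization.exists_smul_eq_mk_rep ℂ v hv
    rw [← ha]
    refine ⟨fun h => ?_, fun h => hZs a v h⟩
    simpa [Units.smul_def] using hZs (a⁻¹ : ℂˣ) _ h
  have hclosed : @IsClosed _ (projTopology W) {x : ℙ ℂ W | x.rep ∈ Z} := by
    rw [isClosed_coinduced]
    have : ((fun v : {v : W // v ≠ 0} => Projectivization.mk ℂ v.1 v.2) ⁻¹'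
        {x : ℙ ℂ W | x.rep ∈ Z}) = Subtype.val ⁻¹' Z := by
      ext v
      exact hZmk v.1 v.2
    rw [this]
    exact hZ.preimage continuous_subtype_val
  have hsub : orbit ρ w ⊆ {x : ℙ ℂ W | x.rep ∈ Z} := by
    rintro _ ⟨σ, hv, rfl⟩
    refine (hZmk _ hv).mpr ⟨?_, ?_⟩
    · rw [hp σ]
      exact V.sum_mem fun l _ => V.smul_mem _ (Submodule.subset_span ⟨l, rfl⟩)
    · obtain ⟨κ, hκ, hf⟩ := hw.exists_fixedByUnipotents hn i σ
      obtain ⟨κ', hκ', c, hc⟩ := hKs κ hκ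
      exact ⟨κ', hκ', hf.scale hc⟩
  let _ := projTopology W
  obtain ⟨-, κ, hκ, hf⟩ := closure_minimal hsub hclosed hh
  exact ⟨κ, hK0 κ hκ, hf⟩

end Topology

end GenPerm

theorem theorem3p4 (n k : ℕ) (hn : 2 ≤ n) (hk : 1 ≤ k)
    {W : Type*} [AddCommGroup W] [Module ℂ W]
    [TopologicalSpace W] [IsTopologicalAddGroup W] [ContinuousSMul ℂ W] [T2Space W]
    (ρ : Representation ℂ (GenPerm.SLPow n k) W) (hρ : GenPerm.IsPolynomialRep ρ)
    (w h : ℙ ℂ W) (hw : GenPerm.IsGenTraceLike ρ w) (hh : GenPerm.IsGenPermanent ρ h) :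
    (∀ ρ' : Representation ℂ (GenPerm.MatPow n k) W, GenPerm.IsPolynomialExtension ρ ρ' →
      ∀ (σ : GenPerm.MatPow n k) (hσ : ρ' σ w.rep ≠ 0),
        Projectivization.mk ℂ (ρ' σ w.rep) hσ ≠ h) ∧
    h ∉ GenPerm.orbitClosure ρ w := by
  refine ⟨?_, fun hcl => ?_⟩
  · rintro ρ' hρ' σ hσ rfl
    obtain ⟨κ, hκ, hf⟩ := hw.exists_fixedByUnipotents_extension hn hρ' ⟨0, hk⟩ σ
    exact hκ (hh.eq_zero_of_fixedByUnipotents (hf.rep_mk hσ))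
  · obtain ⟨κ, hκ, hf⟩ :=
      hw.exists_fixedByUnipotents_of_mem_orbitClosure hn hρ ⟨0, hk⟩ hcl
    exact hκ (hh.eq_zero_of_fixedByUnipotents hf)
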